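/- Let $f(n)=n^2+2bn+c$ for integers $b$ and $c$ such that $\delta:=b^2-c$ is non-zero and square-free, and $\delta\not\equiv 1\pmod 4$. Assume also that $f(n)$ is positive and non-decreasing for integers $n\geq 1$. Put $$g(q)=\tfrac12\sqrt q\,\log q+1.2\sqrt q,\qquad \varkappa=g(4|\delta|),\qquad \xi=\sqrt{1+2|b|+|c|},$$ let $A$ be the least positive integer with $A\geq\max\left(|b|,|c|^{1/2}\right)$, and define $$C_1=1.216(\log\varkappa+2),\qquad C_2=2\left(\varkappa+(\log\varkappa+2)(0.608\log\xi+1.166)\right),\qquad C_3=2\varkappa A.$$ Then $C_1,C_2,C_3$ are positive, and for every integer $N\geq 1$ $$\sum_{n=1}^N\tau(n^2+2bn+c)<C_1N\log N+C_2N+C_3,$$ where $\tau(m)$ denotes the number of positive divisors of $m$. -/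

import Mathlib

namespace QuadDivisorSum

/-- The quadratic polynomial `f(n) = n² + 2bn + c`. -/
def f (b c n : ℤ) : ℤ := n ^ 2 + 2 * b * n + c

/-- The (reduced) discriminant `δ = b² - c`. -/
def delta (b c : ℤ) : ℤ := b ^ 2 - c

/-- The number `τ(m)` of positive divisors of a positive integer `m`. -/
def tau (m : ℤ) : ℕ := m.toNat.divisors.card

/-- `g(q) = ½ √q log q + 1.2 √q`. -/
noncomputable def g (q : ℝ) : ℝ := 1 / 2 * √q * Real.log q + 1.2 * √q

/-- `ϰ = g(4|δ|)`. -/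
noncomputable def kappa (b c : ℤ) : ℝ := g (4 * |(delta b c : ℝ)|)

/-- `ξ = √(1 + 2|b| + |c|)`. -/
noncomputable def xi (b c : ℤ) : ℝ := √(1 + 2 * |(b : ℝ)| + |(c : ℝ)|)

/-- The least positive integer `A` with `A ≥ max (|b|, |c|^{1/2})`. -/
noncomputable def A (b c : ℤ) : ℕ :=
  sInf {a : ℕ | 0 < a ∧ max |(b : ℝ)| (√|(c : ℝ)|) ≤ (a : ℝ)}

/-- The infimum defining `A` is attained, so `A` is indeed the least such integer. -/
theorem A_isLeast (b c : ℤ) :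
    IsLeast {a : ℕ | 0 < a ∧ max |(b : ℝ)| (√|(c : ℝ)|) ≤ (a : ℝ)} (A b c) := by
  refine ⟨Nat.sInf_mem ?_, fun a ha => Nat.sInf_le ha⟩
  obtain ⟨m, hm⟩ := exists_nat_ge (max |(b : ℝ)| (√|(c : ℝ)|))
  refine ⟨m + 1, Nat.succ_pos m, ?_⟩
  push_cast
  linarith

/-- `C₁ = 1.216 (log ϰ + 2)`. -/
noncomputable def C₁ (b c : ℤ) : ℝ := 1.216 * (Real.log (kappa b c) + 2)

/-- `C₂ = 2 (ϰ + (log ϰ + 2)(0.608 log ξ + 1.166))`. -/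
noncomputable def C₂ (b c : ℤ) : ℝ :=
  2 * (kappa b c + (Real.log (kappa b c) + 2) * (0.608 * Real.log (xi b c) + 1.166))

/-- `C₃ = 2 ϰ A`. -/
noncomputable def C₃ (b c : ℤ) : ℝ := 2 * kappa b c * (A b c : ℝ)

end QuadDivisorSum

/-! Pairing each divisor d of m with m/d gives τ(m) ≤ 2·#{d ∣ m : d ≤ √m}. Put X = ⌊√f(N)⌋; since f
is non-decreasing, this one cutoff serves all n ≤ N. Because f(n) = (n+b)² - δ, the n ≤ N with d ∣
f(n) lie in ρ(d) residue classes at most, ρ(d) being the number of square roots of δ mod d. Hence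
the divisor sum is at most 2 ∑_{d≤X} (N/d + 1) ρ(d).

Let χ be the Jacobi symbol (δ/·) on odd integers, extended by 0 to even ones. Checking prime powers
gives ρ ≤ μ² * χ (`sqrtCount_le_sqfreeFun_mul_jacobiFun`). As δ is square-free and not 1 mod 4, χ is
primitive of level 4|δ| (`jacobiChar_isPrimitive`), so Pólya–Vinogradov bounds its partial sums by ϰ
and ∑ ρ(d) ≤ ϰX.

For ∑ ρ(d)/d, the square-free factor contributes at most 1 + log X. The partial sums of χ(m)/m
contribute at most ½ log(2ϰ) + 1, because those of χ are bounded both by ϰ and, χ vanishing on even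
integers, by (m+1)/2. Finally, X ≤ N + A is used in the linear term and X ≤ ξN in the logarithm. -/

open Finset
open scoped NumberTheorySymbols

/-! ### Gauss sums and a Pólya–Vinogradov inequality -/

namespace DirichletCharacter

open ZMod AddChar

/-- The Gauss sum of a primitive quadratic character of level `q` has norm `√q`. -/
theorem norm_gaussSum_of_isPrimitive_of_inv_eq {q : ℕ} [NeZero q] {χ : DirichletCharacter ℂ q}
    (hχ : χ.IsPrimitive) (hinv : χ⁻¹ = χ) : ‖gaussSum χ (stdAddChar (N := q))‖ = √q := by
  have h1 : ∀ k, dft χ k = χ (-k) * gaussSum χ stdAddChar := fun k => by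
    rw [hχ.fourierTransform_eq_inv_mul_gaussSum, hinv]
  have h2 := congrFun (dft_dft (χ : ZMod q → ℂ)) 1
  have h3 : dft (χ : ZMod q → ℂ) = fun k => gaussSum χ stdAddChar * χ (-k) := by
    ext k; rw [h1, mul_comm]
  -- Applying the transform twice and evaluating at 1 gives G² = q χ(-1) for the Gauss sum G; norms
  -- finish the proof.
  rw [h3, dft_const_mul, dft_comp_neg] at h2
  simp only [h1, neg_neg, map_one, one_mul, smul_eq_mul] at h2
  have h4 := congrArg norm h2
  have h5 : ‖χ (-1)‖ = 1 := by
    have := χ.unit_norm_eq_one (-1)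
    simpa using this
  rw [norm_mul, norm_mul, h5, mul_one, Complex.norm_natCast] at h4
  rw [← h4, Real.sqrt_mul_self (norm_nonneg _)]

end DirichletCharacter

/-- Jordan's inequality gives sin(πy) ≥ 2y on [0, 1/2]. The bound is symmetrised so that no case
split at 1/2 survives when summing over frequencies. -/
theorem Real.inv_sin_pi_mul_le {x : ℝ} (h0 : 0 < x) (h1 : x < 1) :
    (Real.sin (Real.pi * x))⁻¹ ≤ (x⁻¹ + (1 - x)⁻¹) / 2 := by
  have key : ∀ y : ℝ, 0 < y → y ≤ 1 / 2 → (Real.sin (Real.pi * y))⁻¹ ≤ y⁻¹ / 2 := by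
    intro y hy hy2
    have := Real.mul_le_sin (x := Real.pi * y) (by positivity) (by nlinarith [Real.pi_pos])
    have e : 2 / Real.pi * (Real.pi * y) = 2 * y := by field_simp
    rw [e] at this
    calc (Real.sin (Real.pi * y))⁻¹ ≤ (2 * y)⁻¹ := inv_anti₀ (by positivity) this
      _ = y⁻¹ / 2 := by field_simp
  have hx : 0 < x⁻¹ := inv_pos.2 h0
  have hx' : 0 < (1 - x)⁻¹ := inv_pos.2 (by linarith)
  rcases le_total x (1 / 2) with h | h
  · linarith [key x h0 h]
  · have := key (1 - x) (by linarith) (by linarith)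
    rw [show Real.pi * (1 - x) = Real.pi - Real.pi * x by ring, Real.sin_pi_sub] at this
    linarith

/-- Each new term is half of 1 - 1/t ≤ log t, with t the ratio of consecutive odd numbers; the
logarithms telescope. -/
theorem sum_range_inv_odd_le (n : ℕ) :
    ∑ i ∈ range (n + 1), ((2 * i + 1 : ℕ) : ℝ)⁻¹ ≤ 1 + 1 / 2 * Real.log (2 * n + 1 : ℕ) := by
  induction n with
  | zero => simp
  | succ n ih =>
    rw [sum_range_succ]
    have h := Real.one_sub_inv_le_log_of_pos
      (x := ((2 * (n + 1) + 1 : ℕ) : ℝ) / ((2 * n + 1 : ℕ) : ℝ)) (by positivity)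
    rw [Real.log_div (by positivity) (by positivity)] at h
    have e : 1 - (((2 * (n + 1) + 1 : ℕ) : ℝ) / ((2 * n + 1 : ℕ) : ℝ))⁻¹
        = 2 * ((2 * (n + 1) + 1 : ℕ) : ℝ)⁻¹ := by
      push_cast; field_simp; ring
    rw [e] at h
    linarith

theorem ZMod.norm_sum_Ioc_stdAddChar_le {q : ℕ} [NeZero q] (y : ℕ) {a : ℕ} (h0 : 0 < a)
    (h1 : a < q) :
    ‖∑ m ∈ Ioc 0 y, ZMod.stdAddChar ((a : ZMod q) * (m : ZMod q))‖
      ≤ (Real.sin (Real.pi * ((a : ℝ) / q)))⁻¹ := by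
  have hq : (0 : ℝ) < q := by exact_mod_cast h0.trans h1
  set z : ℂ := ZMod.stdAddChar (a : ZMod q) with hz
  have hpow : ∀ m : ℕ, ZMod.stdAddChar ((a : ZMod q) * (m : ZMod q)) = z ^ m := by
    intro m
    rw [hz, ← AddChar.map_nsmul_eq_pow, nsmul_eq_mul, mul_comm]
  have hnz : ‖z‖ = 1 := by rw [hz, ZMod.stdAddChar_apply]; exact Circle.norm_coe _
  have hsin : 0 < Real.sin (Real.pi * ((a : ℝ) / q)) := by
    have : (a : ℝ) / q < 1 := by rw [div_lt_one hq]; exact_mod_cast h1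
    have : 0 < (a : ℝ) / q := by positivity
    apply Real.sin_pos_of_pos_of_lt_pi
    · positivity
    · nlinarith [Real.pi_pos]
  have hz1 : ‖z - 1‖ = 2 * Real.sin (Real.pi * ((a : ℝ) / q)) := by
    have : z = Complex.exp (Complex.I * ((2 * Real.pi * ((a : ℝ) / q) : ℝ) : ℂ)) := by
      rw [hz]
      have := ZMod.stdAddChar_coe (N := q) (a : ℤ)
      rw [Int.cast_natCast] at this
      rw [this]
      congr 1
      push_cast
      ring
    rw [this, Complex.norm_exp_I_mul_ofReal_sub_one]
    rw [show 2 * Real.pi * ((a : ℝ) / q) / 2 = Real.pi * ((a : ℝ) / q) by ring]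
    rw [Real.norm_of_nonneg (by positivity)]
  have hsum : (∑ m ∈ Ioc 0 y, z ^ m) * (z - 1) = z * (z ^ y - 1) := by
    have : ∑ m ∈ Ioc 0 y, z ^ m = z * ∑ i ∈ range y, z ^ i := by
      rw [mul_sum, range_eq_Ico, ← Finset.Ico_add_one_add_one_eq_Ioc,
        ← Finset.sum_Ico_add' (fun m => z ^ m) 0 y 1]
      exact sum_congr rfl fun i _ => by rw [pow_succ, mul_comm]
    rw [this, mul_assoc, geom_sum_mul]
  simp only [hpow]
  have h2 := congrArg norm hsum
  rw [norm_mul, hz1, norm_mul, hnz, one_mul] at h2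
  have h3 : ‖z ^ y - 1‖ ≤ 2 := by
    refine (norm_sub_le _ _).trans ?_
    rw [norm_pow, hnz, one_pow, norm_one]; norm_num
  rw [← one_div, le_div_iff₀ hsin]
  linarith

/-- A Pólya–Vinogradov inequality for primitive quadratic characters of even level. -/
theorem DirichletCharacter.norm_sum_Ioc_le_of_isPrimitive {q : ℕ} [NeZero q] {χ : DirichletCharacter ℂ q}
    (hχ : χ.IsPrimitive) (hinv : χ⁻¹ = χ) (hq : 2 ∣ q) (y : ℕ) :
    ‖∑ m ∈ Ioc 0 y, χ (m : ZMod q)‖ ≤ √q * (1 / 2 * Real.log q + 1) := by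
  obtain ⟨h, hh⟩ := even_iff_two_dvd.2 hq
  have hq0 : q ≠ 0 := NeZero.ne q
  obtain ⟨k, rfl⟩ : ∃ k, h = k + 1 := ⟨h - 1, by omega⟩
  have hqr : (0 : ℝ) < q := by positivity
  have h1 : ∀ m : ZMod q, gaussSum χ (ZMod.stdAddChar (N := q)) * χ m
      = ∑ a : ZMod q, χ a * ZMod.stdAddChar (a * m) := by
    intro m
    have := gaussSum_mulShift_of_isPrimitive (ZMod.stdAddChar (N := q)) hχ m
    rw [hinv] at this
    rw [mul_comm, ← this, gaussSum]
    simp only [AddChar.mulShift_apply, mul_comm m]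
  have h2 : gaussSum χ (ZMod.stdAddChar (N := q)) * ∑ m ∈ Ioc 0 y, χ (m : ZMod q)
      = ∑ a ∈ range q, χ (a : ZMod q) *
        ∑ m ∈ Ioc 0 y, ZMod.stdAddChar ((a : ZMod q) * (m : ZMod q)) := by
    rw [mul_sum]
    simp only [h1, mul_sum]
    rw [sum_comm]
    symm
    refine Finset.sum_bij (fun a _ => (a : ZMod q)) (by simp) ?_ ?_ (by simp)
    · intro a ha b hb hab
      rw [ZMod.natCast_eq_natCast_iff] at hab
      exact Nat.ModEq.eq_of_lt_of_lt hab (mem_range.1 ha) (mem_range.1 hb)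
    · intro b _
      exact ⟨b.val, mem_range.2 (ZMod.val_lt b), ZMod.natCast_zmod_val b⟩
  -- Even level leaves only odd frequencies, which halves the logarithm in the final bound.
  have heven : ∀ a : ℕ, _root_.Even a → χ (a : ZMod q) = 0 := by
    intro a ha
    apply χ.map_nonunit
    rw [ZMod.isUnit_iff_coprime]
    intro hc
    have := Nat.dvd_gcd ha.two_dvd (show 2 ∣ q by omega)
    rw [hc] at this
    omega
  have h3 : ‖gaussSum χ (ZMod.stdAddChar (N := q)) * ∑ m ∈ Ioc 0 y, χ (m : ZMod q)‖
      ≤ ∑ i ∈ range (k + 1), (Real.sin (Real.pi * (((2 * i + 1 : ℕ) : ℝ) / q)))⁻¹ := by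
    rw [h2]
    have e : ∀ F : ℕ → ℂ, (∀ a, _root_.Even a → F a = 0) →
        ∀ n, ∑ a ∈ range (2 * n), F a = ∑ i ∈ range n, F (2 * i + 1) := by
      intro F hF n
      induction n with
      | zero => simp
      | succ n ih =>
        rw [show 2 * (n + 1) = 2 * n + 1 + 1 by ring, sum_range_succ, sum_range_succ, ih,
          sum_range_succ, hF (2 * n) (by simp), add_zero]
    have hqk : q = 2 * (k + 1) := by omega
    have e2 := e (fun a => χ (a : ZMod q) *
        ∑ m ∈ Ioc 0 y, ZMod.stdAddChar ((a : ZMod q) * (m : ZMod q)))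
      (fun a ha => by simp [heven a ha]) (k + 1)
    rw [← hqk] at e2
    rw [e2]
    refine (norm_sum_le _ _).trans (sum_le_sum fun i hi => ?_)
    rw [norm_mul]
    have := mem_range.1 hi
    calc _ ≤ 1 * _ := mul_le_mul_of_nonneg_right (χ.norm_le_one _) (norm_nonneg _)
      _ ≤ _ := by
        rw [one_mul]
        exact ZMod.norm_sum_Ioc_stdAddChar_le y (by omega) (by omega)
  have h4 : ∑ i ∈ range (k + 1), (Real.sin (Real.pi * (((2 * i + 1 : ℕ) : ℝ) / q)))⁻¹
      ≤ q * ∑ i ∈ range (k + 1), ((2 * i + 1 : ℕ) : ℝ)⁻¹ := by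
    -- The reflection a ↦ q - a permutes the odd residues, since q is even.
    have e : ∑ i ∈ range (k + 1), (q - (2 * i + 1 : ℕ) : ℝ)⁻¹
        = ∑ i ∈ range (k + 1), ((2 * i + 1 : ℕ) : ℝ)⁻¹ := by
      rw [← Finset.sum_range_reflect]
      refine sum_congr rfl fun i hi => ?_
      have := mem_range.1 hi
      congr 1
      rw [hh]
      have : ((k - i : ℕ) : ℝ) = k - i := Nat.cast_sub (by omega)
      push_cast
      rw [this]; ring
    calc _ ≤ ∑ i ∈ range (k + 1), (q : ℝ) / 2 * (((2 * i + 1 : ℕ) : ℝ)⁻¹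
            + (q - (2 * i + 1 : ℕ) : ℝ)⁻¹) := by
          refine sum_le_sum fun i hi => ?_
          have hi' := mem_range.1 hi
          have hlt : ((2 * i + 1 : ℕ) : ℝ) < q := by exact_mod_cast (by omega : 2 * i + 1 < q)
          have hpos : (0 : ℝ) < ((2 * i + 1 : ℕ) : ℝ) := by positivity
          refine (Real.inv_sin_pi_mul_le (by positivity) ((div_lt_one hqr).2 hlt)).trans
            (le_of_eq ?_)
          have : (q : ℝ) - (2 * i + 1 : ℕ) ≠ 0 := by linarith
          rw [show (1 : ℝ) - (2 * i + 1 : ℕ) / q = (q - (2 * i + 1 : ℕ)) / q by field_simp]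
          rw [inv_div, inv_div]
          field_simp
      _ = _ := by
          rw [← mul_sum, sum_add_distrib, e]; ring
  have h5 := sum_range_inv_odd_le k
  have h6 : Real.log (2 * k + 1 : ℕ) ≤ Real.log q :=
    Real.log_le_log (by positivity) (by exact_mod_cast (by omega : 2 * k + 1 ≤ q))
  rw [norm_mul, DirichletCharacter.norm_gaussSum_of_isPrimitive_of_inv_eq hχ hinv] at h3
  have h7 : √q * ‖∑ m ∈ Ioc 0 y, χ (m : ZMod q)‖
      ≤ √q * (√q * (1 / 2 * Real.log q + 1)) := by
    rw [← mul_assoc, Real.mul_self_sqrt hqr.le]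
    refine h3.trans (h4.trans (mul_le_mul_of_nonneg_left ?_ hqr.le))
    linarith
  exact le_of_mul_le_mul_left h7 (Real.sqrt_pos.2 hqr)

/-! ### The quadratic character attached to δ and its primitivity -/

namespace QuadDivisorSum

/-- The value at `n` of the character attached to `δ`: the Jacobi symbol on odd integers,
`0` on even ones. -/
def oddJacobi (δ : ℤ) (n : ℕ) : ℤ := if Odd n then J(δ | n) else 0

theorem oddJacobi_one (δ : ℤ) : oddJacobi δ 1 = 1 := by simp [oddJacobi]

theorem oddJacobi_mul (δ : ℤ) (m n : ℕ) : oddJacobi δ (m * n) = oddJacobi δ m * oddJacobi δ n := by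
  unfold oddJacobi
  by_cases hm : Odd m
  · by_cases hn : Odd n
    · rw [if_pos hm, if_pos hn, if_pos (hm.mul hn), jacobiSym.mul_right' δ hm.pos.ne' hn.pos.ne']
    · rw [if_neg hn, mul_zero, if_neg fun h => hn (Nat.odd_mul.1 h).2]
  · rw [if_neg hm, zero_mul, if_neg fun h => hm (Nat.odd_mul.1 h).1]

theorem oddJacobi_mod (δ : ℤ) (n : ℕ) : oddJacobi δ (n % (4 * δ.natAbs)) = oddJacobi δ n := by
  have hodd : Odd (n % (4 * δ.natAbs)) ↔ Odd n := by
    rw [Nat.odd_iff, Nat.odd_iff, Nat.mod_mod_of_dvd]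
    exact Dvd.intro (2 * δ.natAbs) (by ring)
  unfold oddJacobi
  by_cases h : Odd n
  · rw [if_pos h, if_pos (hodd.2 h), ← jacobiSym.mod_right δ h]
  · rw [if_neg h, if_neg (mt hodd.1 h)]

theorem oddJacobi_eq_zero_of_not_coprime {δ : ℤ} {n : ℕ} (h : ¬ n.Coprime (4 * δ.natAbs)) :
    oddJacobi δ n = 0 := by
  unfold oddJacobi
  split_ifs with ho
  · rw [jacobiSym.eq_zero_iff]
    refine ⟨ho.pos.ne', fun hc => h ?_⟩
    refine Nat.Coprime.mul_right ?_ ?_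
    · exact (Nat.Coprime.pow_right 2 ho.coprime_two_right)
    · rw [Int.gcd_eq_natAbs, Int.natAbs_natCast] at hc
      exact Nat.Coprime.symm hc
  · rfl

theorem abs_oddJacobi_le (δ : ℤ) (n : ℕ) : |oddJacobi δ n| ≤ 1 := by
  unfold oddJacobi
  split_ifs
  · rcases jacobiSym.trichotomy δ n with h | h | h <;> simp [h]
  · simp

/-- The character of level `4|δ|` attached to `δ`. -/
noncomputable def jacobiChar (δ : ℤ) [NeZero (4 * δ.natAbs)] :
    DirichletCharacter ℂ (4 * δ.natAbs) where
  toFun a := (oddJacobi δ a.val : ℂ)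
  map_one' := by
    have : ((1 : ZMod (4 * δ.natAbs))).val = 1 % (4 * δ.natAbs) := by
      rw [← Nat.cast_one, ZMod.val_natCast]
    rw [this, oddJacobi_mod, oddJacobi_one, Int.cast_one]
  map_mul' a b := by
    rw [ZMod.val_mul, oddJacobi_mod, oddJacobi_mul, Int.cast_mul]
  map_nonunit' a ha := by
    rw [oddJacobi_eq_zero_of_not_coprime, Int.cast_zero]
    intro h
    apply ha
    rw [← ZMod.natCast_zmod_val a, ZMod.isUnit_iff_coprime]
    exact h

theorem jacobiChar_natCast (δ : ℤ) [NeZero (4 * δ.natAbs)] (n : ℕ) :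
    jacobiChar δ (n : ZMod (4 * δ.natAbs)) = (oddJacobi δ n : ℂ) := by
  change ((oddJacobi δ (n : ZMod (4 * δ.natAbs)).val : ℤ) : ℂ) = _
  rw [ZMod.val_natCast, oddJacobi_mod]

theorem jacobiChar_inv (δ : ℤ) [NeZero (4 * δ.natAbs)] : (jacobiChar δ)⁻¹ = jacobiChar δ := by
  refine MulChar.IsQuadratic.inv fun a => ?_
  change ((oddJacobi δ a.val : ℤ) : ℂ) = 0 ∨ ((oddJacobi δ a.val : ℤ) : ℂ) = 1 ∨
    ((oddJacobi δ a.val : ℤ) : ℂ) = -1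
  unfold oddJacobi
  split_ifs
  · rcases jacobiSym.trichotomy δ a.val with h | h | h <;> simp [h]
  · simp

theorem jacobiSym_eq_one_of_modEq_one {m : ℤ} {n : ℕ} (hn : Odd n)
    (h : n ≡ 1 [MOD 4 * m.natAbs]) : J(m | n) = 1 := by
  rw [jacobiSym.mod_right m hn, h, ← jacobiSym.mod_right m odd_one, jacobiSym.one_right]

/-- Write δ = pm with p ∤ m. Take n ≡ 1 mod 4|m| and n a non-residue mod p: then (m/n) = 1, and
reciprocity with n ≡ 1 mod 4 gives (p/n) = (n/p) = -1. -/
theorem exists_jacobiSym_eq_neg_one_of_odd_prime {δ : ℤ} (hsq : Squarefree δ) (h0 : δ ≠ 0)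
    {p : ℕ} (hp : p.Prime) (hp2 : p ≠ 2) (hpδ : (p : ℤ) ∣ δ) :
    ∃ n : ℕ, Odd n ∧ n ≡ 1 [MOD (4 * δ.natAbs) / p] ∧ J(δ | n) = -1 := by
  have := Fact.mk hp
  obtain ⟨m, rfl⟩ := hpδ
  have hm0 : m ≠ 0 := right_ne_zero_of_mul h0
  have hpm : ¬ (p : ℤ) ∣ m := fun ⟨k, hk⟩ => by
    have := hsq p ⟨k, by rw [hk]; ring⟩
    exact (Nat.prime_iff_prime_int.1 hp).not_isUnit this
  have hcop : Nat.Coprime (4 * m.natAbs) p := by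
    refine Nat.Coprime.mul_left ?_ ?_
    · exact Nat.Coprime.pow_left 2 ((Nat.coprime_primes Nat.prime_two hp).2 (Ne.symm hp2))
    · rw [Nat.coprime_comm, hp.coprime_iff_not_dvd]
      exact fun h => hpm (Int.natCast_dvd.2 h)
  obtain ⟨r, hr⟩ := FiniteField.exists_nonsquare (F := ZMod p) (by rwa [ZMod.ringChar_zmod_n])
  obtain ⟨n, hn1, hn2⟩ := Nat.chineseRemainder hcop 1 r.val
  have hn4 : n % 4 = 1 := hn1.of_mul_right _
  have hodd : Odd n := Nat.odd_iff.2 (by omega)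
  refine ⟨n, hodd, ?_, ?_⟩
  · have : 4 * (p * m).natAbs / p = 4 * m.natAbs := by
      rw [Int.natAbs_mul, Int.natAbs_natCast, Nat.mul_left_comm,
        Nat.mul_div_cancel_left _ hp.pos]
    rw [this]; exact hn1
  · rw [jacobiSym.mul_left, jacobiSym_eq_one_of_modEq_one hodd hn1, mul_one,
      jacobiSym.quadratic_reciprocity_one_mod_four' (hp.odd_of_ne_two hp2) hn4,
      ZMod.nonsquare_iff_jacobiSym_eq_neg_one]
    have : ((n : ℤ) : ZMod p) = r := by
      rw [Int.cast_natCast, (ZMod.natCast_eq_natCast_iff _ _ _).2 hn2, ZMod.natCast_zmod_val]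
    rwa [this]

/-- This is the witness at the prime 2, with n = 1 + 2|δ|. If δ = 2m with m odd, then n ≡ 5 mod 8
gives (2/n) = -1, while (m/n) = 1. If δ ≡ 3 mod 4, then n ≡ 3 mod 4, and the sign comes from
reciprocity when δ > 0 and from (-1/n) when δ < 0. -/
theorem jacobiSym_one_add_two_mul_natAbs {δ : ℤ} (hsq : Squarefree δ) (h4 : ¬ δ ≡ 1 [ZMOD 4]) :
    J(δ | 1 + 2 * δ.natAbs) = -1 := by
  have hn4 : ¬ (4 : ℤ) ∣ δ := fun h => by
    have := hsq 2 (by simpa using h)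
    exact absurd this (by decide)
  have hoddn : Odd (1 + 2 * δ.natAbs) := by simp
  have h4' : δ % 4 ≠ 1 := fun h => h4 h
  rcases Int.even_or_odd δ with he | ho
  · obtain ⟨m, rfl⟩ := he.two_dvd
    have hm : Odd m := by
      rw [← Int.not_even_iff_odd]; rintro ⟨k, rfl⟩; exact hn4 ⟨k, by ring⟩
    rw [jacobiSym.mul_left, jacobiSym_eq_one_of_modEq_one (m := m) hoddn, mul_one,
      jacobiSym.at_two hoddn, ZMod.χ₈_nat_eq_if_mod_eight]
    · have : Odd m.natAbs := Int.natAbs_odd.2 hm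
      rw [Int.natAbs_mul]
      obtain ⟨k, hk⟩ := this
      rw [hk]
      have : (1 + 2 * ((2 : ℤ).natAbs * (2 * k + 1))) % 8 = 5 := by
        change (1 + 2 * (2 * (2 * k + 1))) % 8 = 5
        omega
      rw [this]
      simp
    · rw [Int.natAbs_mul, ← mul_assoc]
      change _ ≡ 1 + 0 [MOD _]
      exact Nat.ModEq.add_left 1 ((Nat.modEq_zero_iff_dvd).2 (dvd_refl _))
  · have hodd : Odd δ.natAbs := Int.natAbs_odd.2 ho
    have hself : ∀ a : ℕ, J(((1 + 2 * a : ℕ) : ℤ) | a) = 1 := fun a => by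
      rw [jacobiSym.mod_left' (a₂ := 1), jacobiSym.one_left]
      push_cast
      simp
    have h3 : (1 + 2 * δ.natAbs) % 4 = 3 := by
      obtain ⟨k, hk⟩ := hodd; rw [hk]; omega
    rcases Int.natAbs_eq δ with h | h
    · generalize δ.natAbs = a at *
      subst h
      rw [jacobiSym.quadratic_reciprocity_three_mod_four (by have := Nat.odd_iff.1 hodd; omega) h3,
        hself]
    · generalize δ.natAbs = a at *
      subst h
      rw [jacobiSym.neg _ hoddn,
        jacobiSym.quadratic_reciprocity_one_mod_four
          (by have := Nat.odd_iff.1 hodd; omega) hoddn, hself, ZMod.χ₄_nat_three_mod_four h3, mul_one]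

theorem exists_jacobiSym_eq_neg_one {δ : ℤ} (hsq : Squarefree δ) (h0 : δ ≠ 0)
    (h4 : ¬ δ ≡ 1 [ZMOD 4]) {p : ℕ} (hp : p.Prime) (hpq : p ∣ 4 * δ.natAbs) :
    ∃ n : ℕ, Odd n ∧ n ≡ 1 [MOD (4 * δ.natAbs) / p] ∧ J(δ | n) = -1 := by
  by_cases hp2 : p = 2
  · subst hp2
    refine ⟨1 + 2 * δ.natAbs, by simp, ?_, jacobiSym_one_add_two_mul_natAbs hsq h4⟩
    rw [show 4 * δ.natAbs / 2 = 2 * δ.natAbs by omega]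
    change _ ≡ 1 + 0 [MOD _]
    exact Nat.ModEq.add_left 1 ((Nat.modEq_zero_iff_dvd).2 (dvd_refl _))
  · refine exists_jacobiSym_eq_neg_one_of_odd_prime hsq h0 hp hp2 ?_
    rcases (Nat.Prime.dvd_mul hp).1 hpq with h | h
    · exact absurd ((Nat.prime_dvd_prime_iff_eq hp Nat.prime_two).1
        (hp.dvd_of_dvd_pow (show p ∣ 2 ^ 2 from h))) hp2
    · exact Int.natCast_dvd.2 h

/-- A conductor properly dividing q = 4|δ| would divide q/p for some prime p ∣ q; χ would then be 1
on every unit ≡ 1 mod q/p, against the witness with value -1. -/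
theorem jacobiChar_isPrimitive {δ : ℤ} [NeZero (4 * δ.natAbs)] (hsq : Squarefree δ) (h0 : δ ≠ 0)
    (h4 : ¬ δ ≡ 1 [ZMOD 4]) : (jacobiChar δ).IsPrimitive := by
  rw [DirichletCharacter.isPrimitive_def]
  by_contra hne
  obtain ⟨k, hk⟩ := (jacobiChar δ).conductor_dvd_level
  have hk1 : k ≠ 1 := by rintro rfl; exact hne (hk.trans (mul_one _)).symm
  obtain ⟨p, hp, hpk⟩ := Nat.exists_prime_and_dvd hk1
  obtain ⟨j, rfl⟩ := hpk
  have hqp : 4 * δ.natAbs = p * ((jacobiChar δ).conductor * j) := hk.trans (by ring)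
  have hdiv : 4 * δ.natAbs / p = (jacobiChar δ).conductor * j := by
    exact Nat.div_eq_of_eq_mul_right hp.pos hqp
  obtain ⟨n, hodd, hn1, hJ⟩ := exists_jacobiSym_eq_neg_one hsq h0 h4 hp (Dvd.intro _ hqp.symm)
  have hd : 4 * δ.natAbs / p ∣ 4 * δ.natAbs := Nat.div_dvd_of_dvd (Dvd.intro _ hqp.symm)
  have hft : (jacobiChar δ).FactorsThrough (4 * δ.natAbs / p) :=
    (jacobiChar δ).factorsThrough_conductor.mono _ (Dvd.intro j hdiv.symm) hd
  have hcop : n.Coprime (4 * δ.natAbs) := by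
    by_contra hc
    have := oddJacobi_eq_zero_of_not_coprime hc
    rw [oddJacobi, if_pos hodd, hJ] at this
    omega
  have hker := (DirichletCharacter.factorsThrough_iff_ker_unitsMap hd).1 hft
  have hmem : ZMod.unitOfCoprime n hcop ∈ (ZMod.unitsMap hd).ker := by
    rw [MonoidHom.mem_ker]
    ext
    rw [ZMod.unitsMap_def, Units.coe_map, ZMod.coe_unitOfCoprime]
    simpa using (ZMod.natCast_eq_natCast_iff n 1 (4 * δ.natAbs / p)).2 hn1
  have h1 := hker hmem
  rw [MonoidHom.mem_ker] at h1
  have h2 := congrArg Units.val h1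
  rw [MulChar.coe_toUnitHom, ZMod.coe_unitOfCoprime, jacobiChar_natCast, oddJacobi, if_pos hodd,
    hJ] at h2
  norm_num at h2

/-- Partial sums of the character attached to `δ` are at most `g(4|δ|)`. -/
theorem sum_oddJacobi_le {δ : ℤ} (hsq : Squarefree δ) (h0 : δ ≠ 0)
    (h4 : ¬ δ ≡ 1 [ZMOD 4]) (y : ℕ) :
    ∑ m ∈ Ioc 0 y, (oddJacobi δ m : ℝ) ≤ g (4 * |(δ : ℝ)|) := by
  have : NeZero (4 * δ.natAbs) := ⟨by simpa using h0⟩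
  have h := DirichletCharacter.norm_sum_Ioc_le_of_isPrimitive (jacobiChar_isPrimitive hsq h0 h4)
    (jacobiChar_inv δ) (by omega) y
  have e : ∑ m ∈ Ioc 0 y, jacobiChar δ (m : ZMod (4 * δ.natAbs))
      = ((∑ m ∈ Ioc 0 y, (oddJacobi δ m : ℝ) : ℝ) : ℂ) := by
    rw [Complex.ofReal_sum]
    exact sum_congr rfl fun m _ => by rw [jacobiChar_natCast]; simp
  rw [e, Complex.norm_real, Real.norm_eq_abs] at h
  have hc : ((4 * δ.natAbs : ℕ) : ℝ) = 4 * |(δ : ℝ)| := by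
    rw [Nat.cast_mul, Nat.cast_natAbs, Int.cast_abs]; norm_num
  rw [hc] at h
  refine (le_abs_self _).trans (h.trans ?_)
  unfold g
  have := Real.sqrt_nonneg (4 * |(δ : ℝ)|)
  nlinarith

/-! ### Square roots of δ modulo d -/

/-- The number of solutions of `x² = δ` modulo `d`. -/
noncomputable def sqrtCount (δ : ℤ) (d : ℕ) : ℕ := Nat.card {x : ZMod d // x ^ 2 = (δ : ZMod d)}

theorem sqrtCount_one (δ : ℤ) : sqrtCount δ 1 = 1 := by
  unfold sqrtCount
  rw [Nat.card_eq_one_iff_unique]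
  exact ⟨inferInstance, ⟨0, Subsingleton.elim _ _⟩⟩

theorem sqrtCount_mul_le (δ : ℤ) {m n : ℕ} [NeZero m] [NeZero n] (h : m.Coprime n) :
    sqrtCount δ (m * n) ≤ sqrtCount δ m * sqrtCount δ n := by
  unfold sqrtCount
  rw [← Nat.card_prod]
  let e := ZMod.chineseRemainder h
  have key : ∀ x : ZMod (m * n), x ^ 2 = (δ : ZMod (m * n)) →
      (e x).1 ^ 2 = (δ : ZMod m) ∧ (e x).2 ^ 2 = (δ : ZMod n) := by
    intro x hx
    have := congrArg e hx
    rw [map_pow, map_intCast] at this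
    exact ⟨by simpa using congrArg Prod.fst this, by simpa using congrArg Prod.snd this⟩
  refine Nat.card_le_card_of_injective
    (fun x => (⟨(e x.1).1, (key x.1 x.2).1⟩, ⟨(e x.1).2, (key x.1 x.2).2⟩)) ?_
  intro x y hxy
  simp only [Prod.mk.injEq, Subtype.mk.injEq] at hxy
  exact Subtype.ext (e.injective (Prod.ext hxy.1 hxy.2))

theorem sqrtCount_le_one_of_forall {δ : ℤ} {d : ℕ} [NeZero d]
    (h : ∀ x y : ZMod d, x ^ 2 = (δ : ZMod d) → y ^ 2 = (δ : ZMod d) → x = y) :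
    sqrtCount δ d ≤ 1 := by
  unfold sqrtCount
  rw [Finite.card_le_one_iff_subsingleton]
  exact ⟨fun x y => Subtype.ext (h _ _ x.2 y.2)⟩

theorem sqrtCount_eq_zero_of_forall {δ : ℤ} {d : ℕ}
    (h : ∀ x : ℤ, ¬ (d : ℤ) ∣ x ^ 2 - δ) : sqrtCount δ d = 0 := by
  unfold sqrtCount
  have : IsEmpty {x : ZMod d // x ^ 2 = (δ : ZMod d)} := by
    refine ⟨fun ⟨x, hx⟩ => ?_⟩
    obtain ⟨z, rfl⟩ := ZMod.intCast_surjective x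
    apply h z
    rw [← ZMod.intCast_zmod_eq_zero_iff_dvd]
    push_cast
    rw [hx, sub_self]
  exact Nat.card_of_isEmpty

theorem sqrtCount_prime_pow_eq_zero {δ : ℤ} (hsq : Squarefree δ) {p k : ℕ} (hp : p.Prime)
    (hpδ : (p : ℤ) ∣ δ) (hk : 2 ≤ k) : sqrtCount δ (p ^ k) = 0 := by
  refine sqrtCount_eq_zero_of_forall fun x hx => ?_
  have hpp := Nat.prime_iff_prime_int.1 hp
  have h2 : (p : ℤ) ^ 2 ∣ x ^ 2 - δ := by
    refine dvd_trans ?_ hx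
    push_cast
    exact pow_dvd_pow _ hk
  have h1 : (p : ℤ) ∣ x := by
    refine hpp.dvd_of_dvd_pow (n := 2) ?_
    have := (dvd_trans (dvd_pow_self _ two_ne_zero) h2).add hpδ
    simpa using this
  have h3 : (p : ℤ) ^ 2 ∣ δ := by
    have := (pow_dvd_pow_of_dvd h1 2).sub h2
    simpa using this
  rw [sq] at h3
  exact hpp.not_isUnit (hsq _ h3)

theorem sqrtCount_prime_le_one_of_dvd {δ : ℤ} {p : ℕ} (hp : p.Prime) (hpδ : (p : ℤ) ∣ δ) :
    sqrtCount δ p ≤ 1 := by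
  have := Fact.mk hp
  refine sqrtCount_le_one_of_forall fun x y hx hy => ?_
  rw [(ZMod.intCast_zmod_eq_zero_iff_dvd δ p).2 hpδ] at hx hy
  rw [pow_eq_zero_iff two_ne_zero] at hx hy
  rw [hx, hy]

theorem sqrtCount_two_le_one (δ : ℤ) : sqrtCount δ 2 ≤ 1 := by
  refine sqrtCount_le_one_of_forall fun x y hx hy => ?_
  have : ∀ z : ZMod 2, z ^ 2 = z := by decide
  rw [← this x, ← this y, hx, hy]

theorem sqrtCount_two_pow_eq_zero {δ : ℤ} (hsq : Squarefree δ) (h4 : ¬ δ ≡ 1 [ZMOD 4]) {k : ℕ}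
    (hk : 2 ≤ k) : sqrtCount δ (2 ^ k) = 0 := by
  rcases Int.even_or_odd δ with he | ho
  · exact sqrtCount_prime_pow_eq_zero hsq Nat.prime_two (by exact_mod_cast he.two_dvd) hk
  · refine sqrtCount_eq_zero_of_forall fun x hx => ?_
    have h2 : (4 : ℤ) ∣ x ^ 2 - δ := by
      refine dvd_trans ?_ hx
      push_cast
      exact pow_dvd_pow (2 : ℤ) hk
    apply h4
    rcases Int.even_or_odd' x with ⟨y, rfl | rfl⟩
    · obtain ⟨z, hz⟩ := h2
      obtain ⟨w, rfl⟩ := ho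
      exfalso
      have : 4 * (y ^ 2 - z) = 2 * w + 1 := by linear_combination hz
      omega
    · refine (Int.modEq_iff_dvd.2 ?_)
      have : (1 : ℤ) - δ = ((2 * y + 1) ^ 2 - δ) - 4 * (y ^ 2 + y) := by ring
      rw [this]
      exact h2.sub (Dvd.intro _ rfl)

/-- For two roots x, y, the prime p cannot divide both y - x and y + x, since p ∤ 2x; so p^k divides
one of them. -/
theorem sqrtCount_odd_prime_pow_le_two {δ : ℤ} {p k : ℕ} (hp : p.Prime) (hp2 : p ≠ 2)
    (hpδ : ¬ (p : ℤ) ∣ δ) (hk : k ≠ 0) : sqrtCount δ (p ^ k) ≤ 2 := by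
  classical
  have hpp := Nat.prime_iff_prime_int.1 hp
  have : NeZero (p ^ k) := ⟨pow_ne_zero _ hp.ne_zero⟩
  have key : ∀ x y : ZMod (p ^ k), x ^ 2 = (δ : ZMod (p ^ k)) → y ^ 2 = (δ : ZMod (p ^ k)) →
      y = x ∨ y = -x := by
    intro x y hx hy
    obtain ⟨x, rfl⟩ := ZMod.intCast_surjective x
    obtain ⟨y, rfl⟩ := ZMod.intCast_surjective y
    have hdvd : ((p ^ k : ℕ) : ℤ) ∣ (y - x) * (y + x) := by
      rw [← ZMod.intCast_zmod_eq_zero_iff_dvd]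
      push_cast
      linear_combination hy - hx
    have hx' : ((p ^ k : ℕ) : ℤ) ∣ x ^ 2 - δ := by
      rw [← ZMod.intCast_zmod_eq_zero_iff_dvd]
      push_cast
      rw [hx, sub_self]
    push_cast at hdvd hx'
    have hpx : ¬ (p : ℤ) ∣ x := fun h => hpδ <| by
      have := (h.mul_right x).sub ((dvd_pow_self (p : ℤ) hk).trans hx')
      rwa [show x * x - (x ^ 2 - δ) = δ by ring] at this
    by_cases h1 : (p : ℤ) ∣ y - x
    · left
      have h2 : ¬ (p : ℤ) ∣ y + x := fun h2 => by
        have := h2.sub h1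
        rw [show y + x - (y - x) = 2 * x by ring] at this
        rcases hpp.dvd_or_dvd this with h | h
        · exact hp2 ((Nat.prime_dvd_prime_iff_eq hp Nat.prime_two).1 (by exact_mod_cast h))
        · exact hpx h
      have := hpp.pow_dvd_of_dvd_mul_right k h2 hdvd
      have := (ZMod.intCast_zmod_eq_zero_iff_dvd (y - x) (p ^ k)).2 (by exact_mod_cast this)
      push_cast at this
      exact sub_eq_zero.1 this
    · right
      have := hpp.pow_dvd_of_dvd_mul_left k h1 hdvd
      have := (ZMod.intCast_zmod_eq_zero_iff_dvd (y + x) (p ^ k)).2 (by exact_mod_cast this)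
      push_cast at this
      exact eq_neg_of_add_eq_zero_left this
  unfold sqrtCount
  by_cases hne : ∃ x : ZMod (p ^ k), x ^ 2 = (δ : ZMod (p ^ k))
  · obtain ⟨x, hx⟩ := hne
    rw [Nat.card_eq_fintype_card, Fintype.card_subtype]
    refine (card_le_card (t := {x, -x}) fun y hy => ?_).trans card_le_two
    have := key x y hx (mem_filter.1 hy).2
    simpa using this
  · have : IsEmpty {x : ZMod (p ^ k) // x ^ 2 = (δ : ZMod (p ^ k))} := ⟨fun x => hne ⟨x, x.2⟩⟩
    rw [Nat.card_of_isEmpty]; omega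

theorem sqrtCount_prime_pow_eq_zero_of_jacobiSym {δ : ℤ} {p k : ℕ} (hp : p.Prime)
    (h : J(δ | p) = -1) (hk : k ≠ 0) : sqrtCount δ (p ^ k) = 0 := by
  have := Fact.mk hp
  refine sqrtCount_eq_zero_of_forall fun x hx => ?_
  rw [ZMod.nonsquare_iff_jacobiSym_eq_neg_one] at h
  apply h
  refine ⟨x, ?_⟩
  have : (p : ℤ) ∣ x ^ 2 - δ := by
    refine dvd_trans ?_ hx
    push_cast
    exact dvd_pow_self _ hk
  have := (ZMod.intCast_zmod_eq_zero_iff_dvd _ p).2 this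
  push_cast at this
  linear_combination -this

/-! ### Majorising the root count by the convolution μ² * χ -/

/-- The indicator of squarefree integers as a real arithmetic function. -/
noncomputable def sqfreeFun : ArithmeticFunction ℝ :=
  ⟨fun n => if Squarefree n then 1 else 0, by simp⟩

/-- `oddJacobi δ` as a real arithmetic function. -/
noncomputable def jacobiFun (δ : ℤ) : ArithmeticFunction ℝ :=
  ⟨fun n => (oddJacobi δ n : ℝ), by simp [oddJacobi]⟩

theorem sqfreeFun_apply (n : ℕ) : sqfreeFun n = if Squarefree n then 1 else 0 := rfl

theorem jacobiFun_apply (δ : ℤ) (n : ℕ) : jacobiFun δ n = (oddJacobi δ n : ℝ) := rfl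

theorem isMultiplicative_sqfreeFun : sqfreeFun.IsMultiplicative := by
  refine ⟨by simp [sqfreeFun_apply], fun {m n} h => ?_⟩
  simp only [sqfreeFun_apply, Nat.squarefree_mul h]
  by_cases hm : Squarefree m <;> by_cases hn : Squarefree n <;> simp [hm, hn]

theorem isMultiplicative_jacobiFun (δ : ℤ) : (jacobiFun δ).IsMultiplicative := by
  refine ⟨by simp [jacobiFun_apply, oddJacobi_one], fun {m n} _ => ?_⟩
  simp only [jacobiFun_apply, oddJacobi_mul, Int.cast_mul]

theorem sqfreeFun_mul_jacobiFun_prime_pow (δ : ℤ) {p : ℕ} (hp : p.Prime) (k : ℕ) :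
    (sqfreeFun * jacobiFun δ) (p ^ (k + 1))
      = (oddJacobi δ p : ℝ) ^ (k + 1) + (oddJacobi δ p : ℝ) ^ k := by
  have hpow : ∀ i, jacobiFun δ (p ^ i) = (oddJacobi δ p : ℝ) ^ i := by
    intro i
    rw [jacobiFun_apply]
    induction i with
    | zero => simp [oddJacobi_one]
    | succ i ih => rw [pow_succ, oddJacobi_mul, Int.cast_mul, ih, pow_succ]
  rw [ArithmeticFunction.mul_apply, Nat.sum_divisorsAntidiagonal
    (f := fun i j => sqfreeFun i * jacobiFun δ j), Nat.divisors_prime_pow hp, sum_map]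
  have hsub : range 2 ⊆ range (k + 1 + 1) := range_subset_range.2 (by omega)
  rw [← sum_subset hsub]
  · rw [sum_range_succ, sum_range_one]
    have h1 : Squarefree p := hp.prime.squarefree
    simp only [Function.Embedding.coeFn_mk, pow_zero, Nat.div_one, pow_one, hpow]
    rw [pow_succ p k, Nat.mul_div_cancel _ hp.pos, hpow]
    simp [sqfreeFun_apply, h1]
  · intro i _ hi
    have hi2 : 2 ≤ i := not_lt.1 (mt mem_range.2 hi)
    have : ¬ Squarefree (p ^ i) := fun h => by
      have := h p (by rw [← sq]; exact pow_dvd_pow p hi2)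
      exact hp.prime.not_isUnit this
    simp [sqfreeFun_apply, this]

/-- At p^(k+1) the convolution is χ(p)^(k+1) + χ(p)^k: 2 for split p, 0 for inert p, and for p ∣ 2δ
it is 1 at p and 0 at higher powers. Each value dominates the local root count. -/
theorem sqrtCount_le_sqfreeFun_mul_jacobiFun {δ : ℤ} (hsq : Squarefree δ)
    (h4 : ¬ δ ≡ 1 [ZMOD 4]) (d : ℕ) (hd : d ≠ 0) :
    (sqrtCount δ d : ℝ) ≤ (sqfreeFun * jacobiFun δ) d := by
  have hmul := isMultiplicative_sqfreeFun.mul (isMultiplicative_jacobiFun δ)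
  induction d using Nat.recOnPosPrimePosCoprime with
  | zero => exact absurd rfl hd
  | one => rw [hmul.map_one, sqrtCount_one, Nat.cast_one]
  | coprime a b ha hb hab iha ihb =>
    have : NeZero a := ⟨by omega⟩
    have : NeZero b := ⟨by omega⟩
    rw [hmul.map_mul_of_coprime hab]
    refine le_trans (Nat.cast_le.2 (sqrtCount_mul_le δ hab)) ?_
    push_cast
    exact mul_le_mul (iha (by omega)) (ihb (by omega)) (Nat.cast_nonneg _)
      ((Nat.cast_nonneg _).trans (iha (by omega)))
  | prime_pow p n hp hn =>
    obtain ⟨k, rfl⟩ : ∃ k, n = k + 1 := ⟨n - 1, by omega⟩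
    rw [sqfreeFun_mul_jacobiFun_prime_pow δ hp]
    have ramified : oddJacobi δ p = 0 → sqrtCount δ p ≤ 1 →
        (∀ j, 2 ≤ j → sqrtCount δ (p ^ j) = 0) →
        (sqrtCount δ (p ^ (k + 1)) : ℝ)
          ≤ (oddJacobi δ p : ℝ) ^ (k + 1) + (oddJacobi δ p : ℝ) ^ k := by
      intro h0 h1 h2
      rw [h0]
      rcases k with _ | k
      · simpa using h1
      · simp [h2 (k + 1 + 1) (by omega)]
    by_cases hp2 : p = 2
    · subst hp2
      exact ramified (by simp [oddJacobi]) (sqrtCount_two_le_one δ)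
        fun j hj => sqrtCount_two_pow_eq_zero hsq h4 hj
    · have hodd := hp.odd_of_ne_two hp2
      have hJ : oddJacobi δ p = J(δ | p) := if_pos hodd
      by_cases hpδ : (p : ℤ) ∣ δ
      · refine ramified ?_ (sqrtCount_prime_le_one_of_dvd hp hpδ)
          fun j hj => sqrtCount_prime_pow_eq_zero hsq hp hpδ hj
        apply oddJacobi_eq_zero_of_not_coprime
        rw [hp.coprime_iff_not_dvd, not_not]
        exact (Int.natCast_dvd.1 hpδ).mul_left 4
      · have hg : δ.gcd p = 1 := by
          rw [Int.gcd_eq_natAbs, Int.natAbs_natCast, ← Nat.coprime_iff_gcd_eq_one,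
            Nat.coprime_comm, hp.coprime_iff_not_dvd]
          exact fun h => hpδ (Int.natCast_dvd.2 h)
        rcases jacobiSym.eq_one_or_neg_one hg with h | h
        · rw [hJ, h]
          have := sqrtCount_odd_prime_pow_le_two hp hp2 hpδ (Nat.succ_ne_zero k)
          norm_num
          exact_mod_cast this
        · rw [sqrtCount_prime_pow_eq_zero_of_jacobiSym hp h (Nat.succ_ne_zero k), hJ, h]
          apply le_of_eq
          push_cast
          ring

end QuadDivisorSum

/-! ### Partial summation and averages of the root count -/

theorem sum_Ioc_div_eq_partial_summation (a : ℕ → ℝ) (y : ℕ) :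
    ∑ m ∈ Ioc 0 y, a m / m = (∑ m ∈ Ioc 0 y, a m) / (y + 1)
      + ∑ m ∈ Ioc 0 y, (∑ j ∈ Ioc 0 m, a j) / (m * (m + 1)) := by
  induction y with
  | zero => simp
  | succ y ih =>
    rw [sum_Ioc_succ_top (Nat.zero_le y), ih, sum_Ioc_succ_top (Nat.zero_le y),
      sum_Ioc_succ_top (Nat.zero_le y), sum_Ioc_succ_top (Nat.zero_le y)]
    push_cast
    field_simp
    ring

theorem sum_Ioc_inv_le_one_add_log (n : ℕ) : ∑ m ∈ Ioc 0 n, (m : ℝ)⁻¹ ≤ 1 + Real.log n := by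
  have := harmonic_le_one_add_log n
  rw [harmonic_eq_sum_Icc] at this
  push_cast at this
  exact this

theorem sum_Ioc_div_le_of_partial_sums_le {a : ℕ → ℝ} {K : ℝ} (hK : 1 / 2 ≤ K)
    (h1 : ∀ m, ∑ j ∈ Ioc 0 m, a j ≤ ((m : ℝ) + 1) / 2) (h2 : ∀ m, ∑ j ∈ Ioc 0 m, a j ≤ K) (y : ℕ) :
    ∑ m ∈ Ioc 0 y, a m / m ≤ 1 / 2 * Real.log (2 * K) + 1 := by
  have hlog : 0 ≤ Real.log (2 * K) := Real.log_nonneg (by linarith)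
  have hterm : ∀ n, ∑ m ∈ Ioc 0 n, (∑ j ∈ Ioc 0 m, a j) / (m * (m + 1))
      ≤ 1 / 2 * (1 + Real.log n) := by
    intro n
    refine le_trans ?_ (mul_le_mul_of_nonneg_left (sum_Ioc_inv_le_one_add_log n) (by norm_num))
    rw [mul_sum]
    refine sum_le_sum fun m hm => ?_
    have : (0 : ℝ) < m := by exact_mod_cast (mem_Ioc.1 hm).1
    rw [div_le_iff₀ (by positivity)]
    refine (h1 m).trans (le_of_eq ?_)
    field_simp
  -- The bounds (m+1)/2 and K cross near m = 2K. Up to M the first yields half a harmonic sum;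
  -- beyond M the second telescopes and, with the boundary term, adds K/(M+1) ≤ 1/2.
  set M := ⌊2 * K⌋₊ with hM
  have hM1 : 1 ≤ M := Nat.le_floor (by push_cast; linarith)
  have hMle : (M : ℝ) ≤ 2 * K := Nat.floor_le (by linarith)
  have hMlt : 2 * K < M + 1 := Nat.lt_floor_add_one _
  have hlogM : ∀ n : ℕ, n ≤ M → Real.log n ≤ Real.log (2 * K) := by
    intro n hn
    rcases Nat.eq_zero_or_pos n with rfl | hn0
    · simpa using hlog
    · exact Real.log_le_log (by exact_mod_cast hn0) (le_trans (by exact_mod_cast hn) hMle)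
  rw [sum_Ioc_div_eq_partial_summation]
  rcases le_total y M with hy | hy
  · have e1 : (∑ m ∈ Ioc 0 y, a m) / (y + 1) ≤ 1 / 2 := by
      rw [div_le_iff₀ (by positivity)]; linarith [h1 y]
    linarith [hterm y, hlogM y hy]
  · have e1 : ∀ n, M ≤ n → ∑ m ∈ Ioc 0 n, (∑ j ∈ Ioc 0 m, a j) / (m * (m + 1))
        ≤ 1 / 2 * (1 + Real.log M) + K * (1 / (M + 1) - 1 / (n + 1)) := by
      intro n hn
      induction n, hn using Nat.le_induction with
      | base => simpa using hterm M
      | succ n hn ih =>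
        rw [sum_Ioc_succ_top (Nat.zero_le n)]
        have e2 : (∑ j ∈ Ioc 0 (n + 1), a j) / (((n + 1 : ℕ) : ℝ) * ((n + 1 : ℕ) + 1))
            ≤ K * (1 / (n + 1) - 1 / ((n + 1 : ℕ) + 1)) := by
          rw [div_le_iff₀ (by positivity)]
          refine (h2 (n + 1)).trans (le_of_eq ?_)
          push_cast
          field_simp
          ring
        calc _ ≤ _ := add_le_add ih e2
          _ = _ := by ring
    have e3 : (∑ m ∈ Ioc 0 y, a m) / (y + 1) ≤ K * (1 / (y + 1)) := by
      rw [div_le_iff₀ (by positivity)]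
      refine (h2 y).trans (le_of_eq ?_)
      field_simp
    have e4 : K * (1 / (M + 1)) ≤ 1 / 2 := by
      rw [mul_one_div, div_le_iff₀ (by positivity)]; linarith
    linarith [e1 y hy, hlogM M le_rfl]

namespace QuadDivisorSum

theorem sum_oddJacobi_le_half (δ : ℤ) (m : ℕ) :
    ∑ j ∈ Ioc 0 m, (oddJacobi δ j : ℝ) ≤ ((m : ℝ) + 1) / 2 := by
  have h : ∑ j ∈ Ioc 0 m, oddJacobi δ j ≤ ((m + 1) / 2 : ℤ) := by
    induction m with
    | zero => simp
    | succ m ih =>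
      rw [sum_Ioc_succ_top (Nat.zero_le m)]
      rcases Nat.even_or_odd m with hm | hm
      · have := (abs_le.1 (abs_oddJacobi_le δ (m + 1))).2
        obtain ⟨k, rfl⟩ := hm
        push_cast at *
        omega
      · have : oddJacobi δ (m + 1) = 0 := by
          rw [oddJacobi, if_neg]; rw [Nat.not_odd_iff_even]; exact hm.add_one
        push_cast at *
        omega
  have h2 : 2 * ∑ j ∈ Ioc 0 m, oddJacobi δ j ≤ m + 1 := by omega
  have h3 : (2 : ℝ) * ∑ j ∈ Ioc 0 m, (oddJacobi δ j : ℝ) ≤ m + 1 := by exact_mod_cast h2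
  linarith

theorem sum_Ioc_sqrtCount_le {δ : ℤ} (hsq : Squarefree δ) (h0 : δ ≠ 0) (h4 : ¬ δ ≡ 1 [ZMOD 4])
    (hg : 0 ≤ g (4 * |(δ : ℝ)|)) (X : ℕ) :
    ∑ d ∈ Ioc 0 X, (sqrtCount δ d : ℝ) ≤ g (4 * |(δ : ℝ)|) * X := by
  calc ∑ d ∈ Ioc 0 X, (sqrtCount δ d : ℝ)
      ≤ ∑ d ∈ Ioc 0 X, (sqfreeFun * jacobiFun δ) d := sum_le_sum fun d hd =>
        sqrtCount_le_sqfreeFun_mul_jacobiFun hsq h4 d (mem_Ioc.1 hd).1.ne'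
    _ = ∑ l ∈ Ioc 0 X, sqfreeFun l * ∑ m ∈ Ioc 0 (X / l), jacobiFun δ m :=
        ArithmeticFunction.sum_Ioc_mul_eq_sum_sum _ _ _
    _ ≤ ∑ l ∈ Ioc 0 X, g (4 * |(δ : ℝ)|) := by
        refine sum_le_sum fun l _ => ?_
        rw [sqfreeFun_apply]
        split_ifs
        · rw [one_mul]; exact sum_oddJacobi_le hsq h0 h4 _
        · rwa [zero_mul]
    _ = _ := by rw [sum_const, Nat.card_Ioc, nsmul_eq_mul, mul_comm, Nat.sub_zero]

/-- The arithmetic function `n ↦ F n / n`. -/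
noncomputable def divId (F : ArithmeticFunction ℝ) : ArithmeticFunction ℝ :=
  ⟨fun n => F n / n, by simp⟩

theorem divId_apply (F : ArithmeticFunction ℝ) (n : ℕ) : divId F n = F n / n := rfl

theorem divId_mul_apply (F G : ArithmeticFunction ℝ) (n : ℕ) :
    (divId F * divId G) n = (F * G) n / n := by
  rw [ArithmeticFunction.mul_apply, ArithmeticFunction.mul_apply, sum_div]
  refine sum_congr rfl fun x hx => ?_
  rw [divId_apply, divId_apply, ← (Nat.mem_divisorsAntidiagonal.1 hx).1, Nat.cast_mul,
    div_mul_div_comm]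

theorem sum_Ioc_sqrtCount_div_le {δ : ℤ} (hsq : Squarefree δ) (h0 : δ ≠ 0)
    (h4 : ¬ δ ≡ 1 [ZMOD 4]) (hg : 1 / 2 ≤ g (4 * |(δ : ℝ)|)) (X : ℕ) :
    ∑ d ∈ Ioc 0 X, (sqrtCount δ d : ℝ) / d
      ≤ (1 / 2 * Real.log (2 * g (4 * |(δ : ℝ)|)) + 1) * (1 + Real.log X) := by
  set T := 1 / 2 * Real.log (2 * g (4 * |(δ : ℝ)|)) + 1
  have hT : 0 ≤ T := by
    have := Real.log_nonneg (show (1 : ℝ) ≤ 2 * g (4 * |(δ : ℝ)|) by linarith)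
    positivity
  calc ∑ d ∈ Ioc 0 X, (sqrtCount δ d : ℝ) / d
      ≤ ∑ d ∈ Ioc 0 X, (divId sqfreeFun * divId (jacobiFun δ)) d := by
        refine sum_le_sum fun d hd => ?_
        rw [divId_mul_apply]
        exact div_le_div_of_nonneg_right
          (sqrtCount_le_sqfreeFun_mul_jacobiFun hsq h4 d (mem_Ioc.1 hd).1.ne') (Nat.cast_nonneg _)
    _ = ∑ l ∈ Ioc 0 X, divId sqfreeFun l * ∑ m ∈ Ioc 0 (X / l), divId (jacobiFun δ) m :=
        ArithmeticFunction.sum_Ioc_mul_eq_sum_sum _ _ _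
    _ ≤ ∑ l ∈ Ioc 0 X, T * (l : ℝ)⁻¹ := by
        refine sum_le_sum fun l _ => ?_
        rw [divId_apply, sqfreeFun_apply]
        split_ifs
        · rw [one_div, mul_comm]
          exact mul_le_mul_of_nonneg_right (sum_Ioc_div_le_of_partial_sums_le hg
            (sum_oddJacobi_le_half δ) (sum_oddJacobi_le hsq h0 h4) _) (by positivity)
        · rw [zero_div, zero_mul]; positivity
    _ ≤ _ := by
        rw [← mul_sum]
        exact mul_le_mul_of_nonneg_left (sum_Ioc_inv_le_one_add_log X) hT

/-! ### From the divisor sum to root counts -/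

theorem card_divisors_le_two_mul (m : ℕ) :
    m.divisors.card ≤ 2 * (m.divisors.filter fun d => d * d ≤ m).card := by
  have h := card_filter_add_card_filter_not (s := m.divisors) (fun d => d * d ≤ m)
  have h2 : (m.divisors.filter fun d => ¬ d * d ≤ m).card
      ≤ (m.divisors.filter fun d => d * d ≤ m).card := by
    refine card_le_card_of_injOn (fun d => m / d) ?_ ?_
    · intro d hd
      simp only [coe_filter, Set.mem_ofPred_eq, Nat.mem_divisors, not_le] at hd ⊢
      obtain ⟨⟨⟨e, rfl⟩, hm⟩, hlt⟩ := hd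
      have hd0 : 0 < d := Nat.pos_of_ne_zero (left_ne_zero_of_mul hm)
      rw [Nat.mul_div_cancel_left _ hd0]
      refine ⟨⟨Dvd.intro_left _ rfl, hm⟩, Nat.mul_le_mul_right _ ?_⟩
      exact (lt_of_mul_lt_mul_left hlt hd0.le).le
    · intro d hd d' hd' hdd
      simp only [coe_filter, Set.mem_ofPred_eq, Nat.mem_divisors] at hd hd'
      have h1 := Nat.div_div_self hd.1.1 hd.1.2
      have h2 := Nat.div_div_self hd'.1.1 hd'.1.2
      rw [← h1, ← h2]
      exact congrArg (m / ·) hdd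
  omega

theorem tau_le_two_mul_card {m : ℤ} (hm : 0 < m) {F : ℕ} (hF : m ≤ F) :
    tau m ≤ 2 * ((Ioc 0 (Nat.sqrt F)).filter fun d : ℕ => (d : ℤ) ∣ m).card := by
  lift m to ℕ using hm.le
  rw [tau, Int.toNat_natCast]
  refine (card_divisors_le_two_mul m).trans (Nat.mul_le_mul_left 2 (card_le_card ?_))
  intro d hd
  rw [mem_filter, Nat.mem_divisors] at hd
  rw [mem_filter, mem_Ioc, Int.natCast_dvd_natCast]
  refine ⟨⟨Nat.pos_of_dvd_of_pos hd.1.1 (by omega), ?_⟩, hd.1.1⟩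
  rw [Nat.le_sqrt]
  exact hd.2.trans (by exact_mod_cast hF)

/-- Completing the square sends n to the root n + b of δ mod d. Within one residue class n is
determined by its quotient n / d ≤ N / d. -/
theorem card_filter_dvd_f_le (b c : ℤ) (N : ℕ) {d : ℕ} (hd : 0 < d) :
    ((Icc 1 N).filter fun n : ℕ => (d : ℤ) ∣ f b c n).card
      ≤ (N / d + 1) * sqrtCount (delta b c) d := by
  classical
  have : NeZero d := ⟨hd.ne'⟩
  unfold sqrtCount
  rw [Nat.card_eq_fintype_card, Fintype.card_subtype]
  refine card_le_mul_card_image_of_maps_to (f := fun n : ℕ => (((n : ℤ) + b : ℤ) : ZMod d)) ?_ _ ?_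
  · intro n hn
    rw [mem_filter] at hn ⊢
    refine ⟨mem_univ _, ?_⟩
    have := (ZMod.intCast_zmod_eq_zero_iff_dvd _ d).2 hn.2
    rw [f] at this
    rw [delta]
    push_cast at this ⊢
    linear_combination this
  · intro x _
    rw [← card_range (N / d + 1)]
    refine card_le_card_of_injOn (fun n => n / d) ?_ ?_
    · intro n hn
      simp only [coe_filter, mem_filter, mem_Icc, Set.mem_ofPred_eq] at hn
      exact mem_coe.2 (mem_range.2 (Nat.lt_succ_of_le (Nat.div_le_div_right hn.1.1.2)))
    · intro n hn n' hn' h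
      simp only [coe_filter, mem_filter, Set.mem_ofPred_eq] at hn hn'
      have e := hn.2.trans hn'.2.symm
      push_cast at e
      have e2 := (ZMod.natCast_eq_natCast_iff' _ _ _).1 (add_right_cancel e)
      have h' : n / d = n' / d := h
      rw [← Nat.div_add_mod n d, ← Nat.div_add_mod n' d, e2, h']

theorem sum_tau_le (b c : ℤ) (hpos : ∀ n : ℤ, 1 ≤ n → 0 < f b c n)
    (hmono : MonotoneOn (f b c) (Set.Ici 1)) {N : ℕ} (hN : 1 ≤ N) :
    ∑ n ∈ Icc 1 N, tau (f b c (n : ℤ)) ≤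
      2 * ∑ d ∈ Ioc 0 (Nat.sqrt (f b c N).toNat), (N / d + 1) * sqrtCount (delta b c) d := by
  have hN' : (1 : ℤ) ≤ N := by exact_mod_cast hN
  calc ∑ n ∈ Icc 1 N, tau (f b c (n : ℤ))
      ≤ ∑ n ∈ Icc 1 N, 2 * ((Ioc 0 (Nat.sqrt (f b c N).toNat)).filter
          fun d : ℕ => (d : ℤ) ∣ f b c n).card := by
        refine sum_le_sum fun n hn => ?_
        obtain ⟨h1, h2⟩ := mem_Icc.1 hn
        have h1' : (1 : ℤ) ≤ n := by exact_mod_cast h1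
        refine tau_le_two_mul_card (hpos n h1') ?_
        rw [Int.toNat_of_nonneg (hpos N hN').le]
        exact hmono h1' hN' (by exact_mod_cast h2)
    _ = 2 * ∑ d ∈ Ioc 0 (Nat.sqrt (f b c N).toNat),
          ((Icc 1 N).filter fun n : ℕ => (d : ℤ) ∣ f b c n).card := by
        rw [← mul_sum]
        simp only [card_filter]
        rw [sum_comm]
    _ ≤ _ := Nat.mul_le_mul_left 2 (sum_le_sum fun d hd =>
        card_filter_dvd_f_le b c N (mem_Ioc.1 hd).1)

/-! ### Numerical bounds and conclusion -/

theorem le_kappa {b c : ℤ} (h0 : delta b c ≠ 0) : 3.78 ≤ kappa b c := by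
  have h1 : (1 : ℝ) ≤ |(delta b c : ℝ)| := by
    exact_mod_cast Int.one_le_abs h0
  unfold kappa g
  -- The extreme case is |δ| = 1, where g(4) = log 4 + 2.4 ≈ 3.786.
  have hs : 2 ≤ √(4 * |(delta b c : ℝ)|) := by
    rw [Real.le_sqrt' (by norm_num)]; linarith
  have hl : 2 * Real.log 2 ≤ Real.log (4 * |(delta b c : ℝ)|) := by
    rw [← Real.log_rpow (by norm_num)]
    exact Real.log_le_log (by norm_num) (by norm_num; linarith)
  have := Real.log_two_gt_d9
  nlinarith

theorem le_log_kappa {b c : ℤ} (h0 : delta b c ≠ 0) : 1.3 ≤ Real.log (kappa b c) := by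
  have h := le_kappa h0
  have h1 : Real.log 3.78 ≤ Real.log (kappa b c) := Real.log_le_log (by norm_num) h
  have h2 := Real.one_sub_inv_le_log_of_pos (x := 3.78 / 4) (by norm_num)
  rw [Real.log_div (by norm_num) (by norm_num), show (4 : ℝ) = 2 ^ (2 : ℕ) by norm_num,
    Real.log_pow] at h2
  have := Real.log_two_gt_d9
  norm_num at h2
  norm_num
  linarith

theorem sqrt_f_le_add_A (b c : ℤ) (N : ℕ) (hf : 0 < f b c N) :
    (Nat.sqrt (f b c N).toNat : ℝ) ≤ N + A b c := by
  obtain ⟨-, hA⟩ := (A_isLeast b c).1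
  have hb : |(b : ℝ)| ≤ A b c := (le_max_left _ _).trans hA
  have hc : |(c : ℝ)| ≤ (A b c : ℝ) ^ 2 := Real.sqrt_le_left (by positivity) |>.1
    ((le_max_right _ _).trans hA)
  have h1 : ((Nat.sqrt (f b c N).toNat : ℕ) : ℝ) ^ 2 ≤ (f b c N : ℝ) := by
    have := Nat.sqrt_le' (f b c N).toNat
    have h2 : ((Nat.sqrt (f b c N).toNat ^ 2 : ℕ) : ℤ) ≤ f b c N := by
      rw [← Int.toNat_of_nonneg hf.le]; exact_mod_cast this
    exact_mod_cast h2
  refine abs_le_of_sq_le_sq' (h1.trans ?_) (by positivity) |>.2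
  rw [f]
  push_cast
  have hN : (0 : ℝ) ≤ N := Nat.cast_nonneg N
  nlinarith [le_abs_self (b : ℝ), le_abs_self (c : ℝ)]

theorem sqrt_f_le_xi_mul (b c : ℤ) {N : ℕ} (hN : 1 ≤ N) (hf : 0 < f b c N) :
    (Nat.sqrt (f b c N).toNat : ℝ) ≤ xi b c * N := by
  have h1 : ((Nat.sqrt (f b c N).toNat : ℕ) : ℝ) ^ 2 ≤ (f b c N : ℝ) := by
    have := Nat.sqrt_le' (f b c N).toNat
    have h2 : ((Nat.sqrt (f b c N).toNat ^ 2 : ℕ) : ℤ) ≤ f b c N := by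
      rw [← Int.toNat_of_nonneg hf.le]; exact_mod_cast this
    exact_mod_cast h2
  have hx : 0 ≤ xi b c := Real.sqrt_nonneg _
  refine abs_le_of_sq_le_sq' (h1.trans ?_) (by positivity) |>.2
  rw [mul_pow, xi, Real.sq_sqrt (by positivity), f]
  push_cast
  have hN' : (1 : ℝ) ≤ N := by exact_mod_cast hN
  have e1 : (b : ℝ) * N ≤ |(b : ℝ)| * N ^ 2 :=
    mul_le_mul (le_abs_self _) (by nlinarith) (by linarith) (abs_nonneg _)
  have e2 : (c : ℝ) ≤ |(c : ℝ)| * N ^ 2 :=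
    (le_abs_self _).trans (le_mul_of_one_le_right (abs_nonneg _) (one_le_pow₀ hN'))
  nlinarith

end QuadDivisorSum

theorem theorem1 (b c : ℤ)
    (hδ0 : QuadDivisorSum.delta b c ≠ 0)
    (hδsq : Squarefree (QuadDivisorSum.delta b c))
    (hδ4 : ¬ QuadDivisorSum.delta b c ≡ 1 [ZMOD 4])
    (hpos : ∀ n : ℤ, 1 ≤ n → 0 < QuadDivisorSum.f b c n)
    (hmono : MonotoneOn (QuadDivisorSum.f b c) (Set.Ici 1)) :
    0 < QuadDivisorSum.C₁ b c ∧ 0 < QuadDivisorSum.C₂ b c ∧ 0 < QuadDivisorSum.C₃ b c ∧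
    ∀ N : ℕ, 1 ≤ N →
      ((∑ n ∈ Finset.Icc 1 N, QuadDivisorSum.tau (QuadDivisorSum.f b c (n : ℤ)) : ℕ) : ℝ) <
        QuadDivisorSum.C₁ b c * (N : ℝ) * Real.log (N : ℝ) + QuadDivisorSum.C₂ b c * (N : ℝ) +
          QuadDivisorSum.C₃ b c := by
  open QuadDivisorSum in
  have hκ := le_kappa hδ0
  have hL := le_log_kappa hδ0
  have hκ0 : 0 < kappa b c := by linarith
  have hxi1 : 1 ≤ xi b c := Real.one_le_sqrt.2 (by
    linarith [abs_nonneg (b : ℝ), abs_nonneg (c : ℝ)])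
  have hlogxi : 0 ≤ Real.log (xi b c) := Real.log_nonneg hxi1
  have hA : (0 : ℝ) < A b c := by exact_mod_cast (A_isLeast b c).1.1
  refine ⟨?_, ?_, ?_, fun N hN => ?_⟩
  · unfold C₁; linarith
  · unfold C₂; positivity
  · unfold C₃; positivity
  have hf := hpos N (by exact_mod_cast hN)
  have hX1 := sqrt_f_le_add_A b c N hf
  have hX2 := sqrt_f_le_xi_mul b c hN hf
  have hsum := sum_tau_le b c hpos hmono hN
  have hX0 : 1 ≤ Nat.sqrt (f b c N).toNat := by
    rw [Nat.le_sqrt]; omega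
  generalize Nat.sqrt (f b c N).toNat = X at *
  have hN' : (1 : ℝ) ≤ N := by exact_mod_cast hN
  have hX0' : (1 : ℝ) ≤ X := by exact_mod_cast hX0
  have hlogX0 : 0 ≤ Real.log X := Real.log_nonneg hX0'
  have hlogX : Real.log X ≤ Real.log (xi b c) + Real.log N := by
    rw [← Real.log_mul (by positivity) (by positivity)]
    exact Real.log_le_log (by positivity) hX2
  have h1 := sum_Ioc_sqrtCount_le hδsq hδ0 hδ4 (X := X) hκ0.le
  have h2 := sum_Ioc_sqrtCount_div_le hδsq hδ0 hδ4 (X := X) (show 1 / 2 ≤ kappa b c by linarith)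
  change _ ≤ kappa b c * X at h1
  change _ ≤ (1 / 2 * Real.log (2 * kappa b c) + 1) * (1 + Real.log X) at h2
  rw [Real.log_mul (by norm_num) hκ0.ne'] at h2
  have h3 : ((∑ d ∈ Finset.Ioc 0 X, (N / d + 1) * sqrtCount (delta b c) d : ℕ) : ℝ)
      ≤ N * ∑ d ∈ Finset.Ioc 0 X, (sqrtCount (delta b c) d : ℝ) / d
        + ∑ d ∈ Finset.Ioc 0 X, (sqrtCount (delta b c) d : ℝ) := by
    rw [Finset.mul_sum, ← Finset.sum_add_distrib, Nat.cast_sum]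
    refine Finset.sum_le_sum fun d _ => ?_
    rw [Nat.cast_mul, Nat.cast_add, Nat.cast_one]
    calc ((N / d : ℕ) + 1 : ℝ) * sqrtCount (delta b c) d
        ≤ ((N : ℝ) / d + 1) * sqrtCount (delta b c) d := by
          gcongr; exact Nat.cast_div_le
      _ = _ := by ring
  have h4 : ((∑ n ∈ Finset.Icc 1 N, tau (f b c (n : ℤ)) : ℕ) : ℝ)
      ≤ 2 * ((∑ d ∈ Finset.Ioc 0 X, (N / d + 1) * sqrtCount (delta b c) d : ℕ) : ℝ) := by
    exact_mod_cast hsum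
  set L := Real.log (kappa b c)
  -- Comparing ½(log 2 + L) + 1 with 0.608(L + 2) requires L ≥ 1.21 or so, which `le_log_kappa`
  -- supplies; strictness comes from 0.608 < 1.166.
  have h5 : (1 / 2 * (Real.log 2 + L) + 1) * (1 + Real.log X)
      < (L + 2) * (0.608 * (Real.log (xi b c) + Real.log N) + 1.166) := by
    have hlog2 := Real.log_two_lt_d9
    calc (1 / 2 * (Real.log 2 + L) + 1) * (1 + Real.log X)
        ≤ (0.608 * (L + 2)) * (1 + Real.log X) := by gcongr; linarith
      _ < (L + 2) * (0.608 * Real.log X + 1.166) := by nlinarith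
      _ ≤ _ := by gcongr
  have h6 : (N : ℝ) * ∑ d ∈ Finset.Ioc 0 X, (sqrtCount (delta b c) d : ℝ) / d
      < N * ((L + 2) * (0.608 * (Real.log (xi b c) + Real.log N) + 1.166)) := by
    gcongr
    exact h2.trans_lt h5
  have h7 : kappa b c * X ≤ kappa b c * (N + A b c) := by gcongr
  unfold C₁ C₂ C₃
  change _ < 1.216 * (L + 2) * N * Real.log N +
    2 * (kappa b c + (L + 2) * (0.608 * Real.log (xi b c) + 1.166)) * N + 2 * kappa b c * A b c
  calc _ < 2 * (N * ((L + 2) * (0.608 * (Real.log (xi b c) + Real.log N) + 1.166))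
        + kappa b c * (N + A b c)) := by linarith
    _ = _ := by ring
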